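/- Let $\hat{\xi}_1,\dots,\hat{\xi}_N\in\mathbb{R}^K$ ($N\ge 1$) be samples, let $\|\cdot\|$ be an arbitrary norm on $\mathbb{R}^K$, and let $\varepsilon\in(0,1]$ and $\theta\ge 0$. Let $\mathcal{F}(\theta)$ be the set of all Borel probability measures $\mathbb{P}$ on $\mathbb{R}^K$ whose type-1 Wasserstein distance (with respect to $\|\cdot\|$) from the empirical distribution $\hat{\mathbb{P}}=\frac1N\sum_{i=1}^N\delta_{\hat\xi_i}$ is at most $\theta$. For a measurable loss $\ell$ on $\mathbb{R}^K$ put $\mathbb{P}\text{-CVaR}_\varepsilon(\ell(\tilde\xi))=\inf_{\tau\in\mathbb{R}}\{\tau+\frac1\varepsilon\mathbb{E}_{\mathbb{P}}[(\ell(\tilde\xi)-\tau)^+]\}$. Let $A\in\mathbb{R}^{L\times K}$, $a\in\mathbb{R}^L$, $b\in\mathbb{R}^K$, $b_0\in\mathbb{R}$, and let $x\in\mathbb{R}^L$ be a fixed decision with $A^\top x\ne b$. The safety set is $\mathcal{S}(x)=\{\xi\in\mathbb{R}^K\mid (A\xi+a)^\top x<b^\top\xi+b_0\}$ and the unsafe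 set is $\bar{\mathcal{S}}(x)=\mathbb{R}^K\setminus\mathcal{S}(x)$. For a nonempty closed set $\mathcal{C}\subseteq\mathbb{R}^K$ let $\mathbf{dist}(\xi,\mathcal{C})=\min_{\eta\in\mathcal{C}}\|\eta-\xi\|$; if moreover $\mathcal{C}\neq\mathbb{R}^K$, let the signed distance be $\mathbf{sgn\text{-}dist}(\xi,\mathcal{C})=\mathbf{dist}(\xi,\mathcal{C})$ if $\xi\notin\mathcal{C}$ and $\mathbf{sgn\text{-}dist}(\xi,\mathcal{C})=-\mathbf{dist}(\xi,\mathrm{cl}(\mathbb{R}^K\setminus\mathcal{C}))$ if $\xi\in\mathcal{C}$. For real $s\in[0,N]$ write $\sum_{i=1}^{s}k_i=\sum_{i=1}^{\lfloor s\rfloor}k_i+(s-\lfloor s\rfloor)k_{\lfloor s\rfloor+1}$ (the last term being $0$ when $s=N$). Then, for every permutation $\pi$ of $\{1,\dots,N\}$ that arranges the samples in ascending order of their signed distances to $\bar{\mathcal{S}}(x)$, $$\sup_{\mathbb{P}\in\mathcal{F}(\theta)}\mathbb{P}\text{-CVaR}_\varepsilon\big(a^\top x-b_0+(A^\top x-b)^\top\tilde\xi\big)\le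 0\iff\frac1N\sum_{i=1}^{\varepsilon N}\mathbf{sgn\text{-}dist}\big(\hat\xi_{\pi(i)},\bar{\mathcal{S}}(x)\big)\ge\theta .$$ Moreover, for every sample, $\mathbf{sgn\text{-}dist}(\hat\xi_i,\bar{\mathcal{S}}(x))\le\mathbf{dist}(\hat\xi_i,\bar{\mathcal{S}}(x))$, with equality if $\hat\xi_i\in\mathcal{S}(x)$; whereas $\mathbf{sgn\text{-}dist}(\hat\xi_i,\bar{\mathcal{S}}(x))<0=\mathbf{dist}(\hat\xi_i,\bar{\mathcal{S}}(x))$ if $\hat\xi_i$ lies in the interior of $\bar{\mathcal{S}}(x)$ (fictitious "transportation savings"). -/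

import Mathlib

open MeasureTheory
open scoped ENNReal Matrix

noncomputable section

/-- The empirical distribution `(1/N) ∑ᵢ δ_{ξᵢ}` of the samples `ξ`. -/
def empiricalMeasure {K N : ℕ} (ξ : Fin N → Fin K → ℝ) : Measure (Fin K → ℝ) :=
  (N : ℝ≥0∞)⁻¹ • ∑ i, Measure.dirac (ξ i)

/-- The joint distributions on `ℝᴷ × ℝᴷ` with marginals `P₁` and `P₂`. -/
def couplings {K : ℕ} (P₁ P₂ : Measure (Fin K → ℝ)) :
    Set (Measure ((Fin K → ℝ) × (Fin K → ℝ))) :=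
  {γ | γ.fst = P₁ ∧ γ.snd = P₂}

/-- The type-1 Wasserstein distance with respect to the norm `p`, with values in `[0, ∞]`. -/
def wassersteinDist {K : ℕ} (p : Seminorm ℝ (Fin K → ℝ)) (P₁ P₂ : Measure (Fin K → ℝ)) : ℝ≥0∞ :=
  ⨅ γ ∈ couplings P₁ P₂, ∫⁻ z, ENNReal.ofReal (p (z.1 - z.2)) ∂γ

/-- The Wasserstein ball of radius `θ` around the empirical distribution of the samples `ξ`. -/
def wassersteinBall {K N : ℕ} (p : Seminorm ℝ (Fin K → ℝ)) (ξ : Fin N → Fin K → ℝ) (θ : ℝ) :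
    Set (Measure (Fin K → ℝ)) :=
  {P | IsProbabilityMeasure P ∧ wassersteinDist p P (empiricalMeasure ξ) ≤ ENNReal.ofReal θ}

/-- The conditional value-at-risk `inf_τ (τ + 𝔼_P[(ℓ - τ)⁺] / ε)`. The expectation of the
nonnegative function `(ℓ - τ)⁺` is taken in `[0, ∞]` and the infimum over real `τ` in the
extended reals, so that no integrability or boundedness convention is involved
(`ENNReal.ofReal r` is `r⁺`). -/
def cvar {K : ℕ} (P : Measure (Fin K → ℝ)) (ε : ℝ) (ℓ : (Fin K → ℝ) → ℝ) : EReal :=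
  ⨅ τ : ℝ, ((τ : EReal) +
    (((∫⁻ ζ, ENNReal.ofReal (ℓ ζ - τ) ∂P) / ENNReal.ofReal ε : ℝ≥0∞) : EReal))

/-- The safety set `{ζ | (A ζ + a)ᵀ x < bᵀ ζ + b₀}`. -/
def safetySet {K L : ℕ} (A : Matrix (Fin L) (Fin K) ℝ) (a : Fin L → ℝ) (b : Fin K → ℝ) (b₀ : ℝ)
    (x : Fin L → ℝ) : Set (Fin K → ℝ) :=
  {ζ | (A *ᵥ ζ + a) ⬝ᵥ x < b ⬝ᵥ ζ + b₀}

/-- The unsafe set, the complement of the safety set. -/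
def unsafeSet {K L : ℕ} (A : Matrix (Fin L) (Fin K) ℝ) (a : Fin L → ℝ) (b : Fin K → ℝ) (b₀ : ℝ)
    (x : Fin L → ℝ) : Set (Fin K → ℝ) :=
  (safetySet A a b b₀ x)ᶜ

/-- The loss `aᵀ x - b₀ + (Aᵀ x - b)ᵀ ζ`. -/
def safetyLoss {K L : ℕ} (A : Matrix (Fin L) (Fin K) ℝ) (a : Fin L → ℝ) (b : Fin K → ℝ) (b₀ : ℝ)
    (x : Fin L → ℝ) (ζ : Fin K → ℝ) : ℝ :=
  a ⬝ᵥ x - b₀ + (Aᵀ *ᵥ x - b) ⬝ᵥ ζ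

/-- The distance of `ζ` to a (nonempty) set `C` with respect to the norm `p`. -/
def normDist {K : ℕ} (p : Seminorm ℝ (Fin K → ℝ)) (ζ : Fin K → ℝ) (C : Set (Fin K → ℝ)) : ℝ :=
  sInf ((fun η => p (η - ζ)) '' C)

open Classical in
/-- The signed distance of `ζ` to a closed set `C`: the distance to `C` outside of `C`, and minus
the distance to the closure of the complement of `C` inside `C`. -/
def sgnDist {K : ℕ} (p : Seminorm ℝ (Fin K → ℝ)) (ζ : Fin K → ℝ) (C : Set (Fin K → ℝ)) : ℝ :=
  if ζ ∉ C then normDist p ζ C else -normDist p ζ (closure Cᶜ)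

/-- The partial sum of the first `s ∈ [0, N]` values of `k`, with `s` possibly fractional:
`k₁ + ⋯ + k_⌊s⌋ + (s - ⌊s⌋) k_{⌊s⌋+1}`. The entry `k_{⌊s⌋+1}` has index `⌊s⌋` in `Fin N`; for
`s = N` it does not exist, and its weight is zero. -/
def partialSum {N : ℕ} (k : Fin N → ℝ) (s : ℝ) : ℝ :=
  (∑ i : Fin N, if (i : ℕ) < ⌊s⌋₊ then k i else 0) +
    (s - ⌊s⌋₊) * (if h : ⌊s⌋₊ < N then k ⟨⌊s⌋₊, h⟩ else 0)

end

/-! The loss is affine, `c ⬝ᵥ ζ + d` with `c ≠ 0`. Let `D` be the dual norm of `c`, attained at a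
`p`-unit vector `u`. The signed distance to the unsafe half-space is minus the loss divided by `D`
(`sgnDist_halfSpace`), so ascending distances mean descending losses, and the fractional partial sum
is a weighted sum with weights `w i ∈ [0, 1]` of total `ε * N`.

The worst-case CVaR is `(1/N * ∑ w i * loss i + D * θ) / ε`, whose sign gives the equivalence. The
upper bound takes `τ` to be the loss at the quantile sample and uses that the loss is `D`-Lipschitz
(`cvar_le_of_mem_wassersteinBall`). The lower bound shifts the share `w i` of each atom by `(θ / ε)
• u` (`exists_mem_wassersteinBall_le_cvar`). -/

/-! ### Dual norm and distances to half-spaces -/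

theorem exists_dualNorm_attained {K : ℕ} (p : Seminorm ℝ (Fin K → ℝ)) (hpc : Continuous p)
    (hp : ∀ v, p v = 0 → v = 0) (c : Fin K → ℝ) (hc : c ≠ 0) :
    ∃ (D : ℝ) (u : Fin K → ℝ), 0 < D ∧ p u = 1 ∧ c ⬝ᵥ u = D ∧ ∀ v, c ⬝ᵥ v ≤ D * p v := by
  have hpos : ∀ v, v ≠ 0 → 0 < p v := fun v hv =>
    lt_of_le_of_ne (apply_nonneg p v) fun h => hv (hp v h.symm)
  have : Nontrivial (Fin K → ℝ) := ⟨⟨c, 0, hc⟩⟩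
  have hne : (Metric.sphere (0 : Fin K → ℝ) 1).Nonempty :=
    NormedSpace.sphere_nonempty.2 zero_le_one
  have hs : ∀ v ∈ Metric.sphere (0 : Fin K → ℝ) 1, v ≠ 0 := fun v hv h => by simp [h] at hv
  have hcd : Continuous fun v : Fin K → ℝ => c ⬝ᵥ v := by
    unfold dotProduct
    fun_prop
  obtain ⟨v₀, hv₀, hmax⟩ := (isCompact_sphere (0 : Fin K → ℝ) 1).exists_isMaxOn hne
    (f := fun v => c ⬝ᵥ v / p v)
    (hcd.continuousOn.div hpc.continuousOn fun v hv => (hpos v (hs v hv)).ne')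
  have hp₀ := hpos v₀ (hs v₀ hv₀)
  have hle : ∀ v, c ⬝ᵥ v ≤ c ⬝ᵥ v₀ / p v₀ * p v := by
    intro v
    rcases eq_or_ne v 0 with rfl | hv
    · simp
    have hn : 0 < ‖v‖ := norm_pos_iff.2 hv
    have h := hmax (a := ‖v‖⁻¹ • v) (by simp [norm_smul, hn.ne'])
    simp only [Set.mem_ofPred_eq, map_smul_eq_mul, dotProduct_smul, smul_eq_mul, norm_inv,
      norm_norm] at h
    rw [mul_div_mul_left _ _ (inv_pos.2 hn).ne'] at h
    exact (div_le_iff₀ (hpos v hv)).1 h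
  have hcc : 0 < c ⬝ᵥ c :=
    lt_of_le_of_ne (Finset.sum_nonneg fun i _ => mul_self_nonneg (c i))
      fun h => hc (dotProduct_self_eq_zero.1 h.symm)
  refine ⟨c ⬝ᵥ v₀ / p v₀, (p v₀)⁻¹ • v₀, ?_, ?_, ?_, hle⟩
  -- The bound tested at `c` itself: `0 < c ⬝ᵥ c ≤ D * p c`.
  · exact pos_of_mul_pos_left (hcc.trans_le (hle c)) (apply_nonneg p c)
  · rw [map_smul_eq_mul, Real.norm_of_nonneg (inv_pos.2 hp₀).le, inv_mul_cancel₀ hp₀.ne']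
  · rw [dotProduct_smul, smul_eq_mul, div_eq_inv_mul]

/-- Moving along `u` raises the affine function at the maximal rate `D` per unit of `p`-length, so
`ζ + r • u` is a nearest point. -/
theorem normDist_halfSpace {K : ℕ} (p : Seminorm ℝ (Fin K → ℝ)) (c : Fin K → ℝ) (d D : ℝ)
    (u : Fin K → ℝ) (hD : 0 < D) (hu : p u = 1) (hcu : c ⬝ᵥ u = D)
    (hle : ∀ v, c ⬝ᵥ v ≤ D * p v) (ζ : Fin K → ℝ) :
    normDist p ζ {η | 0 ≤ c ⬝ᵥ η + d} = max 0 (-(c ⬝ᵥ ζ + d) / D) := by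
  set r := max 0 (-(c ⬝ᵥ ζ + d) / D)
  have hr : 0 ≤ r := le_max_left _ _
  refine IsLeast.csInf_eq ⟨⟨ζ + r • u, ?_, ?_⟩, ?_⟩
  · have := (div_le_iff₀ hD).1 (le_max_right 0 (-(c ⬝ᵥ ζ + d) / D))
    simp only [Set.mem_ofPred_eq, dotProduct_add, dotProduct_smul, hcu, smul_eq_mul]
    linarith
  · simp [map_smul_eq_mul, hu, abs_of_nonneg hr]
  · rintro _ ⟨η, hη, rfl⟩
    refine max_le (apply_nonneg p _) ((div_le_iff₀ hD).2 ?_)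
    have := hle (η - ζ)
    rw [dotProduct_sub] at this
    simp only [Set.mem_ofPred_eq] at hη
    linarith

theorem closure_openHalfSpace {K : ℕ} (c : Fin K → ℝ) (hc : c ≠ 0) (d : ℝ) :
    closure {ζ | c ⬝ᵥ ζ + d < 0} = {ζ | c ⬝ᵥ ζ + d ≤ 0} := by
  have hcd : Continuous fun v : Fin K → ℝ => c ⬝ᵥ v + d := by
    unfold dotProduct
    fun_prop
  have hcc : 0 < c ⬝ᵥ c :=
    lt_of_le_of_ne (Finset.sum_nonneg fun i _ => mul_self_nonneg (c i))
      fun h => hc (dotProduct_self_eq_zero.1 h.symm)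
  refine Set.Subset.antisymm
    (closure_minimal (fun ζ h => by
      simp only [Set.mem_ofPred_eq] at h ⊢; exact h.le) (isClosed_le hcd continuous_const)) ?_
  intro ζ hζ
  have ht : Filter.Tendsto (fun t : ℝ => ζ - t • c) (nhdsWithin 0 (Set.Ioi 0)) (nhds ζ) := by
    have : Continuous fun t : ℝ => ζ - t • c := by fun_prop
    simpa using (this.tendsto 0).mono_left nhdsWithin_le_nhds
  refine mem_closure_of_tendsto ht ?_
  filter_upwards [self_mem_nhdsWithin] with t (ht : 0 < t)
  simp only [Set.mem_ofPred_eq, dotProduct_sub, dotProduct_smul, smul_eq_mul] at hζ ⊢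
  nlinarith [mul_pos ht hcc]

theorem sgnDist_halfSpace {K : ℕ} (p : Seminorm ℝ (Fin K → ℝ)) (c : Fin K → ℝ) (hc : c ≠ 0)
    (d D : ℝ) (u : Fin K → ℝ) (hD : 0 < D) (hu : p u = 1) (hcu : c ⬝ᵥ u = D)
    (hle : ∀ v, c ⬝ᵥ v ≤ D * p v) (ζ : Fin K → ℝ) :
    sgnDist p ζ {η | 0 ≤ c ⬝ᵥ η + d} = -(c ⬝ᵥ ζ + d) / D := by
  have hcompl : {η | 0 ≤ c ⬝ᵥ η + d}ᶜ = {η | c ⬝ᵥ η + d < 0} := by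
    ext; simp
  have hneg : {η | c ⬝ᵥ η + d ≤ 0} = {η | 0 ≤ -c ⬝ᵥ η + -d} := by
    ext η
    simp only [Set.mem_ofPred_eq, neg_dotProduct]
    constructor <;> intro h <;> linarith
  unfold sgnDist
  split_ifs with h
  rotate_left
  · rw [normDist_halfSpace p c d D u hD hu hcu hle, max_eq_right]
    simp only [Set.mem_ofPred_eq, not_le] at h
    exact div_nonneg (by linarith) hD.le
  -- The opposite half-space has data `-c`, `-d`, `-u` and the same dual norm `D`.
  · rw [hcompl, closure_openHalfSpace c hc, hneg, normDist_halfSpace p (-c) (-d) D (-u) hD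
      (by simpa using hu) (by simpa using hcu)
      (fun v => by simpa using hle (-v)), max_eq_right]
    · rw [neg_dotProduct]; ring
    · simp only [Set.mem_ofPred_eq] at h
      rw [neg_dotProduct]
      exact div_nonneg (by linarith) hD.le

/-! ### Fractional sums and the empirical measure -/

theorem partialSum_weights {N : ℕ} (hN : 0 < N) (s : ℝ) (hs0 : 0 ≤ s) (hsN : s ≤ N) :
    ∃ (w : Fin N → ℝ) (m : Fin N), (∀ i, 0 ≤ w i) ∧ (∀ i, w i ≤ 1) ∧ ∑ i, w i = s ∧
      (∀ i, i < m → w i = 1) ∧ (∀ i, m < i → w i = 0) ∧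
      ∀ k, partialSum k s = ∑ i, w i * k i := by
  have h1 := Nat.floor_le hs0
  have h2 := Nat.lt_floor_add_one s
  have hfl : ⌊s⌋₊ ≤ N := Nat.floor_le_of_le hsN
  let w : Fin N → ℝ := fun i =>
    if (i : ℕ) < ⌊s⌋₊ then 1 else if (i : ℕ) = ⌊s⌋₊ then s - ⌊s⌋₊ else 0
  have key : ∀ k, partialSum k s = ∑ i, w i * k i := by
    intro k
    have hsplit : ∀ i, w i * k i = (if (i : ℕ) < ⌊s⌋₊ then k i else 0) +
        if (i : ℕ) = ⌊s⌋₊ then (s - ⌊s⌋₊) * k i else 0 := by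
      intro i
      simp only [w]
      split_ifs <;> first | omega | simp
    rw [Finset.sum_congr rfl fun i _ => hsplit i, Finset.sum_add_distrib, partialSum]
    congr 1
    split_ifs with h
    · rw [Finset.sum_eq_single (⟨⌊s⌋₊, h⟩ : Fin N)]
      · simp
      · intro i _ hi
        exact if_neg fun h' => hi (Fin.ext h')
      · simp
    · rw [Finset.sum_eq_zero, mul_zero]
      intro i _
      exact if_neg (by omega)
  have hsum : ∑ i, w i = s := by
    have := key fun _ => 1
    simp only [mul_one] at this
    rw [← this, partialSum, Fin.sum_univ_eq_sum_range
      (fun i => if i < ⌊s⌋₊ then (1 : ℝ) else 0) N, ← Finset.sum_filter]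
    have hf : (Finset.range N).filter (· < ⌊s⌋₊) = Finset.range ⌊s⌋₊ := by
      ext i; simp; omega
    rw [hf]
    split_ifs with h
    · simp
    · have : ⌊s⌋₊ = N := by omega
      simp only [this, Finset.sum_const, Finset.card_range, nsmul_eq_mul, mul_one, mul_zero,
        add_zero] at h1 ⊢
      linarith
  -- For `s = N` the floor is not an index; the last index serves, all weights being 1.
  refine ⟨w, ⟨min ⌊s⌋₊ (N - 1), by omega⟩, ?_, ?_, hsum, ?_, ?_, key⟩
  · intro i; simp only [w]; split_ifs <;> linarith
  · intro i; simp only [w]; split_ifs <;> linarith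
  · intro i hi
    rw [Fin.lt_def] at hi
    exact if_pos (by simp at hi; omega)
  · intro i hi
    rw [Fin.lt_def] at hi
    have : ⌊s⌋₊ < i := by simp at hi; omega
    simp only [w]
    rw [if_neg (by omega), if_neg (by omega)]

theorem lintegral_empiricalMeasure {K N : ℕ} (hN : 0 < N) (ξ : Fin N → Fin K → ℝ)
    (f : (Fin K → ℝ) → ℝ) (hf : ∀ ζ, 0 ≤ f ζ) :
    ∫⁻ ζ, ENNReal.ofReal (f ζ) ∂empiricalMeasure ξ =
      ENNReal.ofReal ((1 / (N : ℝ)) * ∑ i, f (ξ i)) := by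
  rw [empiricalMeasure, lintegral_smul_measure, lintegral_finsetSum_measure,
    ENNReal.ofReal_mul (by positivity), ENNReal.ofReal_sum_of_nonneg fun i _ => hf _, one_div,
    ENNReal.ofReal_inv_of_pos (by exact_mod_cast hN), ENNReal.ofReal_natCast]
  simp

theorem empiricalMeasure_comp_perm {K N : ℕ} (ξ : Fin N → Fin K → ℝ) (π : Equiv.Perm (Fin N)) :
    empiricalMeasure (fun i => ξ (π i)) = empiricalMeasure ξ := by
  simp only [empiricalMeasure]
  rw [Equiv.sum_comp π fun i => Measure.dirac (ξ i)]

/-! ### Bounds on the worst-case CVaR -/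

/-- The easy half of Kantorovich duality: the excess is `D`-Lipschitz for `p`, so integrate over
each coupling and take the infimum. -/
theorem lintegral_excess_le {K : ℕ} (p : Seminorm ℝ (Fin K → ℝ)) (hpc : Continuous p)
    (c : Fin K → ℝ) (d D τ : ℝ) (hD : 0 < D) (hle : ∀ v, c ⬝ᵥ v ≤ D * p v)
    (P Q : Measure (Fin K → ℝ)) :
    ∫⁻ ζ, ENNReal.ofReal (c ⬝ᵥ ζ + d - τ) ∂P ≤
      ∫⁻ ζ, ENNReal.ofReal (c ⬝ᵥ ζ + d - τ) ∂Q + ENNReal.ofReal D * wassersteinDist p P Q := by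
  have hm : Measurable fun ζ : Fin K → ℝ => ENNReal.ofReal (c ⬝ᵥ ζ + d - τ) := by
    have : Continuous fun v : Fin K → ℝ => c ⬝ᵥ v + d - τ := by
      unfold dotProduct
      fun_prop
    exact this.measurable.ennreal_ofReal
  have hmp : Measurable fun z : (Fin K → ℝ) × (Fin K → ℝ) => ENNReal.ofReal (p (z.1 - z.2)) :=
    (hpc.comp (continuous_fst.sub continuous_snd)).measurable.ennreal_ofReal
  have hD0 : ENNReal.ofReal D ≠ 0 := by simpa using hD
  -- Isolate the Wasserstein distance, so that it suffices to bound the cost of each coupling from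
  -- below.
  rw [← tsub_le_iff_left, mul_comm,
    ← ENNReal.div_le_iff_le_mul (Or.inl hD0) (Or.inl ENNReal.ofReal_ne_top)]
  refine le_iInf₂ fun γ hγ => ?_
  rw [ENNReal.div_le_iff_le_mul (Or.inl hD0) (Or.inl ENNReal.ofReal_ne_top), tsub_le_iff_left,
    mul_comm, ← hγ.1, ← hγ.2, Measure.fst, Measure.snd, lintegral_map hm measurable_fst,
    lintegral_map hm measurable_snd, ← lintegral_const_mul _ hmp,
    ← lintegral_add_right _ (hmp.const_mul _)]
  refine lintegral_mono fun z => ?_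
  rw [← ENNReal.ofReal_mul hD.le]
  refine (ENNReal.ofReal_le_ofReal ?_).trans ENNReal.ofReal_add_le
  have := hle (z.1 - z.2)
  rw [dotProduct_sub] at this
  linarith

theorem cvar_le_of_mem_wassersteinBall {K N : ℕ} (hN : 0 < N) (p : Seminorm ℝ (Fin K → ℝ))
    (hpc : Continuous p) (ξ : Fin N → Fin K → ℝ) (ε θ : ℝ) (hε : 0 < ε) (hθ : 0 ≤ θ)
    (c : Fin K → ℝ) (d D : ℝ) (hD : 0 < D) (hle : ∀ v, c ⬝ᵥ v ≤ D * p v)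
    (hanti : Antitone fun i => c ⬝ᵥ ξ i + d)
    (w : Fin N → ℝ) (m : Fin N) (hsum : ∑ i, w i = ε * N)
    (hw1 : ∀ i, i < m → w i = 1) (hw0 : ∀ i, m < i → w i = 0)
    (P : Measure (Fin K → ℝ)) (hP : P ∈ wassersteinBall p ξ θ) :
    cvar P ε (fun ζ => c ⬝ᵥ ζ + d) ≤
      (((1 / (N : ℝ) * ∑ i, w i * (c ⬝ᵥ ξ i + d) + D * θ) / ε : ℝ) : EReal) := by
  have hNr : (0 : ℝ) < N := by exact_mod_cast hN
  set τ := c ⬝ᵥ ξ m + d with hτ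
  -- With this `τ` the positive part is linear in the weights; the fractional weight at `m` is
  -- harmless because the excess vanishes there.
  have hexc : ∀ i, max (c ⬝ᵥ ξ i + d - τ) 0 = w i * (c ⬝ᵥ ξ i + d - τ) := by
    intro i
    rcases lt_trichotomy i m with h | rfl | h
    · rw [hw1 i h, one_mul, max_eq_left]
      exact sub_nonneg.2 (hanti h.le)
    · simp [hτ]
    · rw [hw0 i h, zero_mul, max_eq_right]
      exact sub_nonpos.2 (hanti h.le)
  have hI : ∫⁻ ζ, ENNReal.ofReal (c ⬝ᵥ ζ + d - τ) ∂P ≤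
      ENNReal.ofReal (1 / (N : ℝ) * ∑ i, w i * (c ⬝ᵥ ξ i + d - τ) + D * θ) := by
    have hmax : ∀ ζ : Fin K → ℝ, ENNReal.ofReal (c ⬝ᵥ ζ + d - τ) =
        ENNReal.ofReal (max (c ⬝ᵥ ζ + d - τ) 0) := fun ζ => by
      rw [ENNReal.ofReal_max, ENNReal.ofReal_zero, max_eq_left zero_le]
    refine (lintegral_excess_le p hpc c d D τ hD hle P (empiricalMeasure ξ)).trans ?_
    rw [lintegral_congr hmax, lintegral_empiricalMeasure hN ξ _ fun ζ => le_max_right _ _,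
      Finset.sum_congr rfl fun i _ => hexc i, ENNReal.ofReal_add _ (by positivity),
      ENNReal.ofReal_mul hD.le]
    · gcongr
      exact hP.2
    · refine mul_nonneg (by positivity) (Finset.sum_nonneg fun i _ => ?_)
      rw [← hexc i]
      exact le_max_right _ _
  have hr : 0 ≤ 1 / (N : ℝ) * ∑ i, w i * (c ⬝ᵥ ξ i + d - τ) + D * θ := by
    refine add_nonneg (mul_nonneg (by positivity) (Finset.sum_nonneg fun i _ => ?_))
      (by positivity)
    rw [← hexc i]
    exact le_max_right _ _
  refine (iInf_le _ τ).trans ?_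
  calc _ ≤ (τ : EReal) + ((ENNReal.ofReal
        (1 / (N : ℝ) * ∑ i, w i * (c ⬝ᵥ ξ i + d - τ) + D * θ) / ENNReal.ofReal ε : ℝ≥0∞) :
          EReal) := by
        gcongr
        exact EReal.coe_ennreal_le_coe_ennreal_iff.2 (ENNReal.div_le_div_right hI _)
    _ = _ := by
      rw [← ENNReal.ofReal_div_of_pos hε, EReal.coe_ennreal_ofReal,
        max_eq_left (div_nonneg hr hε.le), ← EReal.coe_add, EReal.coe_eq_coe_iff]
      -- `τ` cancels because the weights sum to `ε * N`.
      simp only [mul_sub, Finset.sum_sub_distrib, ← Finset.sum_mul, hsum]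
      field_simp
      ring

theorem exists_mem_wassersteinBall_le_cvar {K N : ℕ} (hN : 0 < N) (p : Seminorm ℝ (Fin K → ℝ))
    (ξ : Fin N → Fin K → ℝ) (ε θ : ℝ) (hε : 0 < ε) (hθ : 0 ≤ θ)
    (c : Fin K → ℝ) (d D : ℝ) (u : Fin K → ℝ) (hu : p u = 1) (hcu : c ⬝ᵥ u = D)
    (w : Fin N → ℝ) (hw0 : ∀ i, 0 ≤ w i) (hw1 : ∀ i, w i ≤ 1) (hsum : ∑ i, w i = ε * N) :
    ∃ P ∈ wassersteinBall p ξ θ,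
      (((1 / (N : ℝ) * ∑ i, w i * (c ⬝ᵥ ξ i + d) + D * θ) / ε : ℝ) : EReal) ≤
        cvar P ε (fun ζ => c ⬝ᵥ ζ + d) := by
  have hNr : (0 : ℝ) < N := by exact_mod_cast hN
  have hNe : (N : ℝ≥0∞) ≠ 0 := by exact_mod_cast hN.ne'
  have hinv : (N : ℝ≥0∞)⁻¹ = ENNReal.ofReal (1 / N) := by
    rw [one_div, ENNReal.ofReal_inv_of_pos hNr, ENNReal.ofReal_natCast]
  have hone : ∀ i, ENNReal.ofReal (w i) + ENNReal.ofReal (1 - w i) = 1 := fun i => by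
    rw [← ENNReal.ofReal_add (hw0 i) (by linarith [hw1 i])]
    simp
  -- The shift length `θ / ε` makes the cost `(1/N) * (ε * N) * (θ / ε) = θ`.
  let γ : Measure ((Fin K → ℝ) × (Fin K → ℝ)) := (N : ℝ≥0∞)⁻¹ • ∑ i,
    (ENNReal.ofReal (w i) • Measure.dirac (ξ i + (θ / ε) • u, ξ i) +
      ENNReal.ofReal (1 - w i) • Measure.dirac (ξ i, ξ i))
  have hγ : ∀ f : (Fin K → ℝ) × (Fin K → ℝ) → ℝ≥0∞, ∫⁻ z, f z ∂γ = (N : ℝ≥0∞)⁻¹ * ∑ i,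
      (ENNReal.ofReal (w i) * f (ξ i + (θ / ε) • u, ξ i) +
        ENNReal.ofReal (1 - w i) * f (ξ i, ξ i)) := by
    intro f
    simp only [γ, lintegral_smul_measure, lintegral_finsetSum_measure, lintegral_add_measure,
      lintegral_dirac, smul_eq_mul]
  have hsnd : γ.snd = empiricalMeasure ξ := by
    ext s hs
    rw [← lintegral_indicator_one hs, ← lintegral_indicator_one hs, Measure.snd,
      lintegral_map (measurable_one.indicator hs) measurable_snd, hγ, empiricalMeasure,
      lintegral_smul_measure, lintegral_finsetSum_measure]
    simp only [← add_mul, hone, one_mul, lintegral_dirac, smul_eq_mul]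
  have hprob : IsProbabilityMeasure γ := by
    constructor
    rw [← lintegral_one, hγ]
    simp only [mul_one, hone, Finset.sum_const, Finset.card_univ, Fintype.card_fin, nsmul_eq_mul]
    exact ENNReal.inv_mul_cancel hNe (ENNReal.natCast_ne_top N)
  refine ⟨γ.fst, ⟨inferInstance, ?_⟩, le_iInf fun τ => ?_⟩
  · refine (iInf₂_le γ ⟨rfl, hsnd⟩).trans ?_
    rw [hγ, hinv]
    simp only [add_sub_cancel_left, sub_self, map_zero, ENNReal.ofReal_zero, mul_zero, add_zero,
      map_smul_eq_mul, hu, mul_one, ← Finset.sum_mul]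
    rw [← ENNReal.ofReal_sum_of_nonneg fun i _ => hw0 i, hsum,
      Real.norm_of_nonneg (by positivity), ← ENNReal.ofReal_mul (by positivity),
      ← ENNReal.ofReal_mul (by positivity)]
    refine ENNReal.ofReal_le_ofReal (le_of_eq ?_)
    field_simp
  · have hm : Measurable fun ζ : Fin K → ℝ => ENNReal.ofReal (c ⬝ᵥ ζ + d - τ) := by
      have : Continuous fun v : Fin K → ℝ => c ⬝ᵥ v + d - τ := by
        unfold dotProduct
        fun_prop
      exact this.measurable.ennreal_ofReal
    have hI : ENNReal.ofReal (1 / (N : ℝ) *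
        ∑ i, w i * (c ⬝ᵥ (ξ i + (θ / ε) • u) + d - τ)) ≤
        ∫⁻ ζ, ENNReal.ofReal (c ⬝ᵥ ζ + d - τ) ∂γ.fst := by
      rw [Measure.fst, lintegral_map hm measurable_fst, hγ, hinv,
        ENNReal.ofReal_mul (by positivity)]
      gcongr
      -- Replace each excess by its positive part, then discard the unmoved mass `1 - w i`. This
      -- works for every `τ`.
      refine (ENNReal.ofReal_le_ofReal (Finset.sum_le_sum fun i _ =>
        mul_le_mul_of_nonneg_left (le_max_left _ 0) (hw0 i))).trans ?_
      rw [ENNReal.ofReal_sum_of_nonneg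
        fun i _ => mul_nonneg (hw0 i) (le_max_right _ _)]
      refine Finset.sum_le_sum fun i _ => ?_
      rw [ENNReal.ofReal_mul (hw0 i), ENNReal.ofReal_max, ENNReal.ofReal_zero,
        max_eq_left zero_le]
      exact le_self_add
    calc _ = ((τ + (1 / (N : ℝ) * ∑ i, w i * (c ⬝ᵥ (ξ i + (θ / ε) • u) + d - τ)) / ε : ℝ) :
          EReal) := by
          rw [EReal.coe_eq_coe_iff]
          have h : ∀ i, w i * (c ⬝ᵥ (ξ i + (θ / ε) • u) + d - τ) =
              w i * (c ⬝ᵥ ξ i + d) + w i * (θ / ε * D - τ) := fun i => by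
            rw [dotProduct_add, dotProduct_smul, hcu, smul_eq_mul]; ring
          rw [Finset.sum_congr rfl fun i _ => h i, Finset.sum_add_distrib, ← Finset.sum_mul, hsum]
          field_simp
          ring
      _ ≤ (τ : EReal) + ((ENNReal.ofReal (1 / (N : ℝ) *
          ∑ i, w i * (c ⬝ᵥ (ξ i + (θ / ε) • u) + d - τ)) / ENNReal.ofReal ε : ℝ≥0∞) :
            EReal) := by
          rw [← ENNReal.ofReal_div_of_pos hε, EReal.coe_ennreal_ofReal, EReal.coe_add]
          gcongr
          exact le_max_left _ _
      _ ≤ _ := by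
          gcongr
          exact EReal.coe_ennreal_le_coe_ennreal_iff.2 (ENNReal.div_le_div_right hI _)

/-! ### Reduction to a half-space and conclusion -/

theorem safetyLoss_eq {K L : ℕ} (A : Matrix (Fin L) (Fin K) ℝ) (a : Fin L → ℝ) (b : Fin K → ℝ)
    (b₀ : ℝ) (x : Fin L → ℝ) :
    safetyLoss A a b b₀ x = fun ζ => (Aᵀ *ᵥ x - b) ⬝ᵥ ζ + (a ⬝ᵥ x - b₀) := by
  funext ζ
  rw [safetyLoss, add_comm]

theorem safetySet_eq {K L : ℕ} (A : Matrix (Fin L) (Fin K) ℝ) (a : Fin L → ℝ) (b : Fin K → ℝ)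
    (b₀ : ℝ) (x : Fin L → ℝ) :
    safetySet A a b b₀ x = {ζ | (Aᵀ *ᵥ x - b) ⬝ᵥ ζ + (a ⬝ᵥ x - b₀) < 0} := by
  ext ζ
  have h : (A *ᵥ ζ) ⬝ᵥ x = (Aᵀ *ᵥ x) ⬝ᵥ ζ := by
    rw [dotProduct_comm, Matrix.dotProduct_mulVec, Matrix.mulVec_transpose]
  simp only [safetySet, Set.mem_ofPred_eq, add_dotProduct, sub_dotProduct, h]
  constructor <;> intro h <;> linarith

theorem unsafeSet_eq {K L : ℕ} (A : Matrix (Fin L) (Fin K) ℝ) (a : Fin L → ℝ) (b : Fin K → ℝ)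
    (b₀ : ℝ) (x : Fin L → ℝ) :
    unsafeSet A a b b₀ x = {ζ | 0 ≤ (Aᵀ *ᵥ x - b) ⬝ᵥ ζ + (a ⬝ᵥ x - b₀)} := by
  ext ζ
  simp [unsafeSet, safetySet_eq]

theorem mainTheorem2 {K L N : ℕ} (hN : 0 < N)
    (p : Seminorm ℝ (Fin K → ℝ)) (hp : ∀ v, p v = 0 → v = 0)
    (ξ : Fin N → Fin K → ℝ) (ε θ : ℝ) (hε0 : 0 < ε) (hε1 : ε ≤ 1) (hθ : 0 ≤ θ)
    (A : Matrix (Fin L) (Fin K) ℝ) (a : Fin L → ℝ) (b : Fin K → ℝ) (b₀ : ℝ)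
    (x : Fin L → ℝ) (hx : Aᵀ *ᵥ x ≠ b) :
    (∀ π : Equiv.Perm (Fin N),
      Monotone (fun i => sgnDist p (ξ (π i)) (unsafeSet A a b b₀ x)) →
      ((⨆ P ∈ wassersteinBall p ξ θ, cvar P ε (safetyLoss A a b b₀ x)) ≤ 0 ↔
        θ ≤ (1 / (N : ℝ)) *
          partialSum (fun i => sgnDist p (ξ (π i)) (unsafeSet A a b b₀ x)) (ε * N))) ∧
    (∀ i, sgnDist p (ξ i) (unsafeSet A a b b₀ x) ≤ normDist p (ξ i) (unsafeSet A a b b₀ x)) ∧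
    (∀ i, ξ i ∈ safetySet A a b b₀ x →
      sgnDist p (ξ i) (unsafeSet A a b b₀ x) = normDist p (ξ i) (unsafeSet A a b b₀ x)) ∧
    (∀ i, ξ i ∈ interior (unsafeSet A a b b₀ x) →
      normDist p (ξ i) (unsafeSet A a b b₀ x) = 0 ∧
        sgnDist p (ξ i) (unsafeSet A a b b₀ x) < 0) := by
  have hc : Aᵀ *ᵥ x - b ≠ 0 := sub_ne_zero.2 hx
  -- A convex function on a finite-dimensional space is continuous.
  have hpc : Continuous p := by
    rw [← continuousOn_univ]
    exact p.convexOn.continuousOn isOpen_univ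
  rw [safetyLoss_eq, safetySet_eq, unsafeSet_eq]
  generalize Aᵀ *ᵥ x - b = c at hc
  generalize a ⬝ᵥ x - b₀ = d
  obtain ⟨D, u, hD, hu, hcu, hle⟩ := exists_dualNorm_attained p hpc hp c hc
  have hsgn := sgnDist_halfSpace p c hc d D u hD hu hcu hle
  have hdist := normDist_halfSpace p c d D u hD hu hcu hle
  have hNr : (0 : ℝ) < N := by exact_mod_cast hN
  refine ⟨fun π hmono => ?_, fun i => ?_, fun i hi => ?_, fun i hi => ?_⟩
  · simp only [hsgn] at hmono ⊢
    obtain ⟨w, m, hw0, hw1, hsum, hwlt, hwgt, hw⟩ := partialSum_weights hN (ε * N)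
      (by positivity) (mul_le_of_le_one_left hNr.le hε1)
    have hanti : Antitone fun i => c ⬝ᵥ ξ (π i) + d := fun i j hij => by
      have := (div_le_div_iff_of_pos_right hD).1 (hmono hij)
      exact neg_le_neg_iff.1 this
    have hball : wassersteinBall p ξ θ = wassersteinBall p (fun i => ξ (π i)) θ := by
      simp only [wassersteinBall, empiricalMeasure_comp_perm]
    have hval : (1 / (N : ℝ)) * partialSum (fun i => -(c ⬝ᵥ ξ (π i) + d) / D) (ε * N) =
        -(1 / (N : ℝ) * ∑ i, w i * (c ⬝ᵥ ξ (π i) + d)) / D := by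
      simp only [hw, neg_div, mul_neg, Finset.sum_neg_distrib, mul_div_assoc',
        ← Finset.sum_div]
    rw [hball, hval, le_div_iff₀ hD]
    constructor
    · intro h
      obtain ⟨P, hP, hPle⟩ := exists_mem_wassersteinBall_le_cvar hN p (fun i => ξ (π i)) ε θ
        hε0 hθ c d D u hu hcu w hw0 hw1 hsum
      have h0 := (hPle.trans (le_iSup₂_of_le P hP le_rfl)).trans h
      rw [← EReal.coe_zero, EReal.coe_le_coe_iff, div_le_iff₀ hε0] at h0
      linarith
    · intro h
      refine iSup₂_le fun P hP => (cvar_le_of_mem_wassersteinBall hN p hpc (fun i => ξ (π i)) ε θ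
        hε0 hθ c d D hD hle hanti w m hsum hwlt hwgt P hP).trans ?_
      rw [← EReal.coe_zero, EReal.coe_le_coe_iff]
      exact div_nonpos_of_nonpos_of_nonneg (by linarith) hε0.le
  · rw [hsgn, hdist]
    exact le_max_right _ _
  · rw [hsgn, hdist, max_eq_right]
    simp only [Set.mem_ofPred_eq] at hi
    exact div_nonneg (by linarith) hD.le
  · have hcompl : {ζ | 0 ≤ c ⬝ᵥ ζ + d}ᶜ = {ζ | c ⬝ᵥ ζ + d < 0} := by
      ext; simp
    -- In the interior the loss is strictly positive, hence the signed distance is strictly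
    -- negative.
    rw [interior_eq_compl_closure_compl, hcompl, closure_openHalfSpace c hc] at hi
    simp only [Set.mem_compl_iff, Set.mem_ofPred_eq, not_le] at hi
    have hneg : -(c ⬝ᵥ ξ i + d) / D < 0 := div_neg_of_neg_of_pos (by linarith) hD
    rw [hsgn, hdist]
    exact ⟨max_eq_left hneg.le, hneg⟩
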